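/- Let $\lambda$ be an (infinite) regular cardinal and let $\mathcal{A}$ be a small category which is $\lambda$-complete and $\lambda$-cocomplete, i.e. it has all limits and all colimits indexed by categories with fewer than $\lambda$ arrows. Assume that $\mathcal{A}$ is not a preorder, i.e. that some two objects of $\mathcal{A}$ have two distinct parallel arrows between them. Let $\mathsf{Ind}_\lambda\mathcal{A}\subseteq \mathsf{Set}^{\mathcal{A}^{\circ}}$ be the full subcategory of those presheaves that are colimits of small $\lambda$-filtered diagrams of representables, let $\mathsf{Pro}_\lambda\mathcal{A}=(\mathsf{Ind}_\lambda(\mathcal{A}^{\circ}))^{\circ}$, and let $i:\mathcal{A}\to\mathsf{Ind}_\lambda\mathcal{A}$ and $i^\sharp:\mathcal{A}\to\mathsf{Pro}_\lambda\mathcal{A}$ be the canonical inclusions (the Yoneda embedding of $\mathcal{A}$ and the opposite of the Yoneda embedding of $\mathcal{A}^\circ$). Then the following cannot happen simultaneously: 1. $i:\mathcal{A}\to\mathsf{Ind}_\lambda\mathcal{A}$ is codense, i.e. the identity functor of $\mathsf{Ind}_\lambda\mathcal{A}$, with the canonical $2$-cell, is a pointwise right Kan extension of $i$ along itself; 2.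 $i^\sharp:\mathcal{A}\to\mathsf{Pro}_\lambda\mathcal{A}$ is dense, i.e. the identity functor of $\mathsf{Pro}_\lambda\mathcal{A}$, with the canonical $2$-cell, is a pointwise left Kan extension of $i^\sharp$ along itself. -/

import Mathlib

universe w

namespace RestrictedIsbell

open CategoryTheory CategoryTheory.Limits Opposite

/-- `A` is `κ`-complete: it has all limits indexed by categories with fewer than `κ` arrows. -/
def IsCardinalComplete (A : Type w) [SmallCategory A] (κ : Cardinal.{w}) : Prop :=
  ∀ (J : Type w) [SmallCategory J], HasCardinalLT (Arrow J) κ → HasLimitsOfShape J A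

/-- `A` is `κ`-cocomplete: it has all colimits indexed by categories with fewer than `κ` arrows. -/
def IsCardinalCocomplete (A : Type w) [SmallCategory A] (κ : Cardinal.{w}) : Prop :=
  ∀ (J : Type w) [SmallCategory J], HasCardinalLT (Arrow J) κ → HasColimitsOfShape J A

/-- A presheaf on `A` is a `κ`-ind-object if it is the colimit of a small `κ`-filtered diagram
of representable presheaves. -/
def isCardinalIndObject (A : Type w) [SmallCategory A] (κ : Cardinal.{w}) [Fact κ.IsRegular] :
    ObjectProperty (Aᵒᵖ ⥤ Type w) :=
  fun P => ∃ (J : Type w) (_ : SmallCategory J) (_ : IsCardinalFiltered J κ) (F : J ⥤ A)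
    (ι : F ⋙ yoneda ⟶ (Functor.const J).obj P), Nonempty (IsColimit (Cocone.mk P ι))

/-- Representable presheaves are `κ`-ind-objects. -/
lemma isCardinalIndObject_yoneda (A : Type w) [SmallCategory A] (κ : Cardinal.{w})
    [Fact κ.IsRegular] (X : A) : isCardinalIndObject A κ (yoneda.obj X) :=
  ⟨Discrete PUnit.{w + 1}, inferInstance,
    ⟨fun _ _ => ⟨{ pt := ⟨PUnit.unit⟩, ι := { app := fun _ => eqToHom (Subsingleton.elim _ _) } }⟩⟩,
    Functor.fromPUnit X, { app := fun _ => 𝟙 _ },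
    ⟨{ desc := fun s => s.ι.app ⟨PUnit.unit⟩
       fac := fun s j => Category.id_comp _
       uniq := fun _ m h => (Category.id_comp m).symm.trans (h ⟨PUnit.unit⟩) }⟩⟩

/-- `Ind_κ A`, the full subcategory of `Set^(Aᵒᵖ)` on the `κ`-ind-objects. -/
abbrev IndCompletion (A : Type w) [SmallCategory A] (κ : Cardinal.{w}) [Fact κ.IsRegular] :
    Type (w + 1) :=
  (isCardinalIndObject A κ).FullSubcategory

/-- The canonical inclusion `i : A ⥤ Ind_κ A`, i.e. the corestricted Yoneda embedding. -/
def indInclusion (A : Type w) [SmallCategory A] (κ : Cardinal.{w}) [Fact κ.IsRegular] :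
    A ⥤ IndCompletion A κ :=
  (isCardinalIndObject A κ).lift yoneda (isCardinalIndObject_yoneda A κ)

/-- `Pro_κ A = (Ind_κ Aᵒᵖ)ᵒᵖ`. -/
abbrev ProCompletion (A : Type w) [SmallCategory A] (κ : Cardinal.{w}) [Fact κ.IsRegular] :
    Type (w + 1) :=
  (IndCompletion Aᵒᵖ κ)ᵒᵖ

/-- The canonical inclusion `i♯ : A ⥤ Pro_κ A`, i.e. the opposite of the canonical inclusion
`Aᵒᵖ ⥤ Ind_κ Aᵒᵖ`. -/
def proInclusion (A : Type w) [SmallCategory A] (κ : Cardinal.{w}) [Fact κ.IsRegular] :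
    A ⥤ ProCompletion A κ :=
  (indInclusion Aᵒᵖ κ).rightOp

/-- A functor `F : C ⥤ D` is codense if the identity of `D`, with the canonical 2-cell, is a
pointwise right Kan extension of `F` along itself. This is dual to `Functor.IsDense`. -/
def IsCodense {C D : Type*} [Category* C] [Category* D] (F : C ⥤ D) : Prop :=
  Nonempty ((Functor.RightExtension.mk (𝟭 D)
    (Functor.rightUnitor F).hom).IsPointwiseRightKanExtension)

end RestrictedIsbell

/-!
Fix an object `b`, a set `I` of cardinality at least `κ`, and let `l` be the filter on `I` of sets
whose complement has fewer than `κ` elements. Since `l` is closed under intersections of fewer than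
`κ` sets, the presheaf `K` of germs along `l` of families `I → (x ⟶ b)` preserves `κ`-small limits,
hence is a `κ`-ind-object.

If `i♯` is dense, a natural operation turning families `I → (x ⟶ b)` into morphisms `x ⟶ c` is a
morphism to `c` from the formal power of `b` by `I`; that power is the `κ`-cofiltered limit in
`Pro_κ A` of the powers of `b` by small subsets of `I`, so the operation depends on fewer than `κ`
coordinates. A family may be changed on such a set without changing its germ, so every morphism
from `K` to a representable is constant. If `i` is codense, these morphisms separate the points of
`K`, among which are the germs of the constant families; so `b` receives at most one morphism from
each object.
-/

namespace RestrictedIsbell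

open CategoryTheory CategoryTheory.Limits Opposite Filter

section ReducedPower

variable {I : Type w}

/-- The reduced power `X ↦ X ^ I / l` along a filter `l`, i.e. germs along `l` of functions from
`I`, as an endofunctor of the category of sets. -/
def reducedPower (l : Filter I) : Type w ⥤ Type w where
  obj X := Germ l X
  map f := TypeCat.ofHom (Germ.map f)
  map_id X := by
    ext g
    induction g using Germ.inductionOn
    rfl
  map_comp f f' := by
    ext g
    induction g using Germ.inductionOn
    rfl

lemma preservesLimitsOfShape_reducedPower (l : Filter I) [l.NeBot] {κ : Cardinal.{w}}
    [CardinalInterFilter l κ] {J : Type w} [SmallCategory J] (hJ : HasCardinalLT (Arrow J) κ) :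
    PreservesLimitsOfShape J (reducedPower l) where
  preservesLimit {F} :=
    { preserves := fun {c} hc => by
        have hArrow : Cardinal.mk (Arrow J) < κ := (hasCardinalLT_iff_cardinal_mk_lt _ _).1 hJ
        have hObj : Cardinal.mk J < κ :=
          (hasCardinalLT_iff_cardinal_mk_lt _ _).1 (hasCardinalLT_of_hasCardinalLT_arrow hJ)
        have glue_section := (Types.isLimit_iff c).1 ⟨hc⟩
        refine (Types.isLimit_iff _).2 fun s hs => ?_
        choose r hr using fun j => Quotient.exists_rep (s j)
        change ∀ j, ((r j : I → F.obj j) : Germ l (F.obj j)) = s j at hr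
        have compatible : ∀ᶠ i in l, ∀ e : Arrow J, F.map e.hom (r e.left i) = r e.right i :=
          (eventually_cardinal_forall hArrow).2 fun e => by
            have := hs e.hom
            rw [← hr, ← hr] at this
            exact Germ.coe_eq.1 this
        have glue : ∀ᶠ i in l, ∃! x : c.pt, ∀ j, c.π.app j x = r j i :=
          compatible.mono fun i hi => glue_section (fun j => r j i) fun u => hi (Arrow.mk u)
        obtain ⟨t, ht⟩ := (glue.mono fun _ h => h.exists).choice
        refine ⟨((t : I → c.pt) : Germ l c.pt), fun j => ?_, fun g hg => ?_⟩
        · rw [← hr]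
          exact Germ.coe_eq.2 (ht.mono fun i hi => hi j)
        · induction g using Germ.inductionOn with | _ t'
          have ht' : ∀ᶠ i in l, ∀ j, c.π.app j (t' i) = r j i :=
            (eventually_cardinal_forall hObj).2 fun j =>
              Germ.coe_eq.1 ((hg j).trans (hr j).symm)
          refine Germ.coe_eq.2 ?_
          filter_upwards [glue, ht, ht'] with i hglue hi hi'
          exact hglue.unique hi' hi }

lemma eq_of_dependsOn_of_compl_mem {l : Filter I} {X Y : Type*} {f : Germ l X → Y} {S : Set I}
    (hf : DependsOn (fun t : I → X => f t) S) (hS : Sᶜ ∈ l) (g g' : Germ l X) : f g = f g' := by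
  classical
  induction g, g' using Germ.inductionOn₂ with | _ t t'
  have h : ((S.piecewise t t' : I → X) : Germ l X) = t' :=
    Germ.coe_eq.2 (Filter.mem_of_superset hS fun i hi => Set.piecewise_eq_of_notMem S t t' hi)
  calc
    f t = f (S.piecewise t t' : I → X) :=
      hf fun i hi => (Set.piecewise_eq_of_mem S t t' hi).symm
    _ = f t' := congrArg f h

end ReducedPower

section Ind

variable {A : Type w} [SmallCategory A] {κ : Cardinal.{w}} [Fact κ.IsRegular]

lemma isCardinalFiltered_of_hasColimitsOfShape (C : Type*) [Category* C]
    (h : ∀ (J : Type w) [SmallCategory J], HasCardinalLT (Arrow J) κ → HasColimitsOfShape J C) :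
    IsCardinalFiltered C κ where
  nonempty_cocone {J} _ F hJ := by
    have := h J hJ
    exact ⟨colimit.cocone F⟩

lemma isCardinalFiltered_costructuredArrow_yoneda (hcolim : IsCardinalCocomplete A κ)
    {P : Aᵒᵖ ⥤ Type w} (hP : ∀ (J : Type w) [SmallCategory J], HasCardinalLT (Arrow J) κ →
      PreservesLimitsOfShape J P) :
    IsCardinalFiltered (CostructuredArrow yoneda P) κ := by
  have : IsCardinalFiltered P.Elementsᵒᵖ κ :=
    isCardinalFiltered_of_hasColimitsOfShape _ fun J _ hJ => by
      have := hcolim J hJ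
      have := hP Jᵒᵖ ((hasCardinalLT_arrow_op_iff J κ).2 hJ)
      have : HasLimitsOfShape Jᵒᵖ Aᵒᵖ := hasLimitsOfShape_opposite_opposite_iff.2 inferInstance
      exact hasColimitsOfShape_opposite_iff.2 inferInstance
  exact .of_equivalence κ (CategoryOfElements.costructuredArrowYonedaEquivalence P)

lemma isCardinalIndObject_of_preservesLimitsOfShape (hcolim : IsCardinalCocomplete A κ)
    {P : Aᵒᵖ ⥤ Type w} (hP : ∀ (J : Type w) [SmallCategory J], HasCardinalLT (Arrow J) κ →
      PreservesLimitsOfShape J P) :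
    isCardinalIndObject A κ P :=
  ⟨CostructuredArrow yoneda P, inferInstance,
    isCardinalFiltered_costructuredArrow_yoneda hcolim hP, CostructuredArrow.proj yoneda P,
    (Presheaf.tautologicalCocone P).ι, ⟨Presheaf.isColimitTautologicalCocone P⟩⟩

instance : (indInclusion A κ).Full :=
  inferInstanceAs ((isCardinalIndObject A κ).lift yoneda _).Full

instance : (indInclusion A κ).Faithful :=
  inferInstanceAs ((isCardinalIndObject A κ).lift yoneda _).Faithful

noncomputable instance {J : Type w} [SmallCategory J] [IsCardinalFiltered J κ] (F : J ⥤ A) :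
    CreatesColimit (F ⋙ indInclusion A κ) (isCardinalIndObject A κ).ι :=
  createsColimitFullSubcategoryInclusion' (F ⋙ indInclusion A κ)
    (colimit.isColimit (F ⋙ yoneda))
    ⟨J, inferInstance, inferInstance, F, (colimit.cocone (F ⋙ yoneda)).ι, ⟨colimit.isColimit _⟩⟩

instance {J : Type w} [SmallCategory J] [IsCardinalFiltered J κ] (F : J ⥤ A) :
    HasColimit (F ⋙ indInclusion A κ) :=
  have : HasColimit ((F ⋙ indInclusion A κ) ⋙ (isCardinalIndObject A κ).ι) :=
    inferInstanceAs (HasColimit (F ⋙ yoneda))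
  hasColimit_of_created _ (isCardinalIndObject A κ).ι

lemma exists_eq_map_comp_colimit_ι {J : Type w} [SmallCategory J] [IsCardinalFiltered J κ]
    {F : J ⥤ A} {c : A} (f : (indInclusion A κ).obj c ⟶ colimit (F ⋙ indInclusion A κ)) :
    ∃ (j : J) (g : c ⟶ F.obj j),
      f = (indInclusion A κ).map g ≫ colimit.ι (F ⋙ indInclusion A κ) j := by
  let ev : IndCompletion A κ ⥤ Type w :=
    (isCardinalIndObject A κ).ι ⋙ (evaluation Aᵒᵖ (Type w)).obj (op c)
  obtain ⟨j, g, hg⟩ := Types.jointly_surjective_of_isColimit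
    (isColimitOfPreserves ev (colimit.isColimit (F ⋙ indInclusion A κ))) (yonedaEquiv f.hom)
  change c ⟶ F.obj j at g
  refine ⟨j, g, ObjectProperty.hom_ext _ (yonedaEquiv.injective (hg.symm.trans ?_))⟩
  exact ((yonedaEquiv_comp (yoneda.map g) (colimit.ι (F ⋙ indInclusion A κ) j).hom).trans
    (congrArg _ (yonedaEquiv_yoneda_map g))).symm

end Ind

section FormalCopower

variable {A : Type w} [SmallCategory A] (κ : Cardinal.{w}) (I : Type w) (b : A)
  [∀ S : HasCardinalLT.Set I κ, HasCoproduct fun _ : S.1 => b]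

/-- The diagram of the copowers `∐_S b` of `b`, for `S ⊆ I` of cardinality `< κ`. -/
noncomputable def smallCopowers : HasCardinalLT.Set I κ ⥤ A where
  obj S := ∐ fun _ : S.1 => b
  map u := Sigma.map' (Set.inclusion (leOfHom u)) fun _ => 𝟙 b
  map_id _ := Sigma.map'_id_id
  map_comp u v := by simp [Sigma.map'_comp_map']

variable {I b} in
lemma smallCopowers_map_comp_desc {x : A} (t : I → (b ⟶ x)) {S T : HasCardinalLT.Set I κ}
    (u : S ⟶ T) :
    (smallCopowers κ I b).map u ≫ Sigma.desc (fun i : T.1 => t i) =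
      Sigma.desc fun i : S.1 => t i := by
  refine Sigma.hom_ext _ _ fun i => ?_
  simp [smallCopowers]

variable [Fact κ.IsRegular]

/-- The copower of `b` by `I` in `Ind_κ A`, for `I` of any cardinality: the formal `κ`-filtered
colimit of the small copowers, which need not be representable. -/
noncomputable def formalCopower : IndCompletion A κ :=
  colimit (smallCopowers κ I b ⋙ indInclusion A κ)

namespace formalCopower

variable {I b}

/-- The canonical morphism from the copower by a small `S ⊆ I` to the formal copower by `I`. -/
noncomputable def incl (S : HasCardinalLT.Set I κ) :
    (indInclusion A κ).obj (∐ fun _ : S.1 => b) ⟶ formalCopower κ I b :=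
  colimit.ι (smallCopowers κ I b ⋙ indInclusion A κ) S

variable (b) in
/-- The coprojections of the formal copower. -/
noncomputable def ι (i : I) : (indInclusion A κ).obj b ⟶ formalCopower κ I b :=
  let S : HasCardinalLT.Set I κ :=
    ⟨{i}, hasCardinalLT_of_finite _ _ (Fact.out : κ.IsRegular).aleph0_le⟩
  (indInclusion A κ).map (Sigma.ι (fun _ : S.1 => b) ⟨i, Set.mem_singleton i⟩) ≫ incl κ S

/-- The morphism out of the formal copower induced by a family of morphisms. -/
noncomputable def desc {x : A} (t : I → (b ⟶ x)) :
    formalCopower κ I b ⟶ (indInclusion A κ).obj x :=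
  colimit.desc (smallCopowers κ I b ⋙ indInclusion A κ)
    { pt := (indInclusion A κ).obj x
      ι :=
        { app := fun S => (indInclusion A κ).map (Sigma.desc fun i : S.1 => t i)
          naturality := fun _ _ u =>
            (Functor.map_comp _ _ _).symm.trans
              ((congrArg (indInclusion A κ).map (smallCopowers_map_comp_desc κ t u)).trans
                (Category.comp_id _).symm) } }

lemma incl_desc {x : A} (t : I → (b ⟶ x)) (S : HasCardinalLT.Set I κ) :
    incl κ S ≫ desc κ t = (indInclusion A κ).map (Sigma.desc fun i : S.1 => t i) :=
  colimit.ι_desc _ _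

lemma ι_desc {x : A} (t : I → (b ⟶ x)) (i : I) :
    ι κ b i ≫ desc κ t = (indInclusion A κ).map (t i) := by
  rw [ι, Category.assoc, incl_desc, ← Functor.map_comp, Sigma.ι_desc]

lemma exists_eq_map_comp_incl {c : A} (d : (indInclusion A κ).obj c ⟶ formalCopower κ I b) :
    ∃ (S : HasCardinalLT.Set I κ) (g : c ⟶ ∐ fun _ : S.1 => b),
      d = (indInclusion A κ).map g ≫ incl κ S :=
  exists_eq_map_comp_colimit_ι d

lemma exists_dependsOn_comp_desc {c : A}
    (d : (indInclusion A κ).obj c ⟶ formalCopower κ I b) :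
    ∃ S : Set I, HasCardinalLT S κ ∧
      ∀ x : A, DependsOn (fun t : I → (b ⟶ x) => d ≫ desc κ t) S := by
  obtain ⟨S, g, rfl⟩ := exists_eq_map_comp_incl κ d
  refine ⟨S.1, S.2, fun x t t' h => ?_⟩
  have hS : (fun i : S.1 => t i) = fun i : S.1 => t' i := funext fun i => h i i.2
  simp only [Category.assoc, incl_desc, hS]

end formalCopower

end FormalCopower

section Density

lemma IsCodense.hom_ext {C D : Type*} [Category* C] [Category* D] {F : C ⥤ D} (h : IsCodense F)
    {X Y : D} {u v : X ⟶ Y} (huv : ∀ (c : C) (m : Y ⟶ F.obj c), u ≫ m = v ≫ m) : u = v :=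
  (h.some Y).hom_ext fun j => by
    change u ≫ j.hom ≫ 𝟙 _ = v ≫ j.hom ≫ 𝟙 _
    rw [Category.comp_id]
    exact huv _ j.hom

lemma exists_comp_eq_of_isDense {C D : Type*} [Category* C] [Category* D] (F : C ⥤ D) [F.IsDense]
    {Y Z : D} (s : ∀ x : C, (F.obj x ⟶ Y) → (F.obj x ⟶ Z))
    (hs : ∀ ⦃x y : C⦄ (u : x ⟶ y) (τ : F.obj y ⟶ Y), s x (F.map u ≫ τ) = F.map u ≫ s y τ) :
    ∃ d : Y ⟶ Z, ∀ (x : C) (τ : F.obj x ⟶ Y), τ ≫ d = s x τ := by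
  let φ : (Presheaf.restrictedULiftYoneda.{0} F).obj Y ⟶
      (Presheaf.restrictedULiftYoneda.{0} F).obj Z :=
    { app := fun x => TypeCat.ofHom fun τ => ULift.up (s x.unop τ.down)
      naturality := fun x y u => by
        ext τ
        exact congrArg ULift.up (hs u.unop τ.down) }
  obtain ⟨d, hd⟩ := (Presheaf.restrictedULiftYoneda.{0} F).map_surjective φ
  exact ⟨d, fun x τ => congrArg (fun α => (α.app (op x) (ULift.up τ)).down) hd⟩

variable {A : Type w} [SmallCategory A] {κ : Cardinal.{w}} [Fact κ.IsRegular]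

instance : (proInclusion A κ).Full :=
  inferInstanceAs (indInclusion Aᵒᵖ κ).rightOp.Full

instance : (proInclusion A κ).Faithful :=
  inferInstanceAs (indInclusion Aᵒᵖ κ).rightOp.Faithful

lemma exists_dependsOn_of_isDense [(proInclusion A κ).IsDense] {I : Type w} {b c : A}
    [∀ S : HasCardinalLT.Set I κ, HasProduct fun _ : S.1 => b]
    (φ : ∀ x : A, (I → (x ⟶ b)) → (x ⟶ c))
    (hφ : ∀ ⦃x y : A⦄ (u : x ⟶ y) (t : I → (y ⟶ b)), φ x (fun i => u ≫ t i) = u ≫ φ y t) :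
    ∃ S : Set I, HasCardinalLT S κ ∧ ∀ x : A, DependsOn (φ x) S := by
  let j := proInclusion A κ
  let Q : ProCompletion A κ := op (formalCopower κ I (op b))
  let π (i : I) : Q ⟶ j.obj b := (formalCopower.ι κ (op b) i).op
  let lift {x : A} (t : I → (x ⟶ b)) : j.obj x ⟶ Q := (formalCopower.desc κ fun i => (t i).op).op
  have lift_π {x : A} (t : I → (x ⟶ b)) (i : I) : lift t ≫ π i = j.map (t i) :=
    congrArg Quiver.Hom.op (formalCopower.ι_desc κ (fun i => (t i).op) i)
  obtain ⟨d, hd⟩ := exists_comp_eq_of_isDense j (Y := Q)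
    (fun x τ => j.map (φ x fun i => j.preimage (τ ≫ π i))) fun x y u τ => by
      simp [← hφ, ← Functor.map_comp]
  obtain ⟨S, hS, hdS⟩ := formalCopower.exists_dependsOn_comp_desc κ d.unop
  refine ⟨S, hS, fun x t t' h => j.map_injective ?_⟩
  have lift_d (t : I → (x ⟶ b)) : lift t ≫ d = j.map (φ x t) := by
    simp [hd, lift_π]
  rw [← lift_d, ← lift_d]
  exact congrArg Quiver.Hom.op (hdS (op x) fun i hi => congrArg Quiver.Hom.op (h i hi))

lemma app_eq_app_of_isDense [(proInclusion A κ).IsDense] {I : Type w} {l : Filter I}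
    (hl : ∀ S : Set I, HasCardinalLT S κ → Sᶜ ∈ l) {b c : A}
    [∀ S : HasCardinalLT.Set I κ, HasProduct fun _ : S.1 => b]
    (m : yoneda.obj b ⋙ reducedPower l ⟶ yoneda.obj c) {x : A} (g g' : Germ l (x ⟶ b)) :
    m.app (op x) g = m.app (op x) g' := by
  obtain ⟨S, hS, hm⟩ := exists_dependsOn_of_isDense (κ := κ) (I := I) (b := b) (c := c)
    (fun x t => m.app (op x) (t : Germ l (x ⟶ b)))
    fun _ y u t => NatTrans.naturality_apply m u.op (t : Germ l (y ⟶ b))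
  exact eq_of_dependsOn_of_compl_mem (f := fun g => m.app (op x) g) (hm x) (hl S hS) g g'

end Density

section Thin

variable {A : Type w} [SmallCategory A] {κ : Cardinal.{w}} [Fact κ.IsRegular]

lemma isCardinalIndObject_yoneda_comp_reducedPower (hcolim : IsCardinalCocomplete A κ)
    {I : Type w} (l : Filter I) [l.NeBot] [CardinalInterFilter l κ] (b : A) :
    isCardinalIndObject A κ (yoneda.obj b ⋙ reducedPower l) :=
  isCardinalIndObject_of_preservesLimitsOfShape hcolim fun _ _ hJ =>
    have := preservesLimitsOfShape_reducedPower l hJ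
    comp_preservesLimitsOfShape _ _

lemma subsingleton_hom_of_isCodense_of_isDense {b : A}
    (hpow : ∀ T : Type w, HasCardinalLT T κ → HasProduct fun _ : T => b)
    (hcolim : IsCardinalCocomplete A κ) (hcodense : IsCodense (indInclusion A κ))
    (hdense : (proInclusion A κ).IsDense) (x : A) : Subsingleton (x ⟶ b) := by
  let I : Type w := κ.out
  let l : Filter I := cocardinal I (Fact.out : κ.IsRegular)
  have : l.NeBot := by
    rw [← frequently_true_iff_neBot, frequently_cocardinal]
    simp [I]
  have compl_mem (S : Set I) (hS : HasCardinalLT S κ) : Sᶜ ∈ l :=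
    compl_mem_cocardinal_of_card_lt ((hasCardinalLT_iff_cardinal_mk_lt _ _).1 hS)
  have (S : HasCardinalLT.Set I κ) : HasProduct fun _ : S.1 => b := hpow S.1 S.2
  let K : IndCompletion A κ := ⟨_, isCardinalIndObject_yoneda_comp_reducedPower hcolim l b⟩
  let point (f : x ⟶ b) : (indInclusion A κ).obj x ⟶ K :=
    ObjectProperty.homMk (yonedaEquiv.symm (f : Germ l (x ⟶ b)))
  refine ⟨fun f f' => ?_⟩
  have point_eq : point f = point f' := hcodense.hom_ext fun c m => by
    refine ObjectProperty.hom_ext _ (yonedaEquiv.injective ?_)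
    exact (yonedaEquiv_comp _ m.hom).trans
      ((app_eq_app_of_isDense (κ := κ) compl_mem m.hom _ _).trans (yonedaEquiv_comp _ m.hom).symm)
  exact Germ.const_inj.1 (yonedaEquiv.symm.injective (congrArg (·.hom) point_eq))

end Thin

end RestrictedIsbell

theorem corollary2_general (A : Type w) [CategoryTheory.SmallCategory A]
    (κ : Cardinal.{w}) [Fact κ.IsRegular]
    (hpow : ∀ T : Type w, HasCardinalLT T κ →
      ∀ b : A, CategoryTheory.Limits.HasProduct fun _ : T => b)
    (hcolim : RestrictedIsbell.IsCardinalCocomplete A κ)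
    (hthin : ¬ Quiver.IsThin A) :
    ¬ (RestrictedIsbell.IsCodense (RestrictedIsbell.indInclusion A κ) ∧
      (RestrictedIsbell.proInclusion A κ).IsDense) := by
  rintro ⟨hcodense, hdense⟩
  exact hthin fun x b => RestrictedIsbell.subsingleton_hom_of_isCodense_of_isDense
    (fun T hT => hpow T hT b) hcolim hcodense hdense x

theorem corollary2 (A : Type w) [CategoryTheory.SmallCategory A]
    (κ : Cardinal.{w}) [Fact κ.IsRegular]
    (hlim : RestrictedIsbell.IsCardinalComplete A κ)
    (hcolim : RestrictedIsbell.IsCardinalCocomplete A κ)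
    (hthin : ¬ Quiver.IsThin A) :
    ¬ (RestrictedIsbell.IsCodense (RestrictedIsbell.indInclusion A κ) ∧
      (RestrictedIsbell.proInclusion A κ).IsDense) := by
  refine corollary2_general A κ (fun T hT b => ?_) hcolim hthin
  have := hlim (CategoryTheory.Discrete T) (by simpa using hT)
  infer_instance
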